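/- Consider $N$ spins of spin $s\in\{\tfrac12,1,\tfrac32,\dots\}$, with total spin operators $\hat Q^z,\hat Q^\pm$ (the sums of the one-site spin operators). For every $N$ such that $J:=sN$ is an integer, let $|J,M\rangle$, $M=-J,\dots,J$, be a standard basis of the spin-$J$ irrep of $SU(2)$, i.e. unit vectors with $\hat Q^z|J,M\rangle=M|J,M\rangle$ and $\hat Q^\pm|J,M\rangle=\sqrt{(J\mp M)(J\pm M+1)}\,|J,M\pm1\rangle$. For a set $\alpha$ of $d$ erased sites with complement $\bar\alpha$, let $\rho_M:=\mathrm{Tr}_{\bar\alpha}\big[|J,M\rangle\langle J,M|\big]$ be the reduced state on the erased sites, and let $f(\rho,\sigma):=\|\sqrt\sigma\sqrt\rho\|_1=\mathrm{Tr}\sqrt{\sqrt\rho\,\sigma\sqrt\rho}$ denote the fidelity. There is an absolute constant $C>0$ such that the following holds. Let $s$ be as above, let $1>b\ge c$ be real numbers, and for each $N$ let $M=M_N$ be an integer and $\alpha=\alpha_N$ a set of $d=d_N$ of the $N$ sites, with $|M_N|=O(N^b)$ and $d_N=O(N^c)$ as $N\to\infty$ (in particular this covers $|M_N|\sim N^b$,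 $d_N\sim N^c$ up to constant factors). Then, for all sufficiently large $N$ with $sN$ an integer, $$|1-f(\rho_M,\rho_0)|\le C\,\frac{dM^2}{sN^2},$$ and, as $N\to\infty$ through such $N$, $$f(\rho_M,\rho_0)=1-O\big(N^{2b+c-2}\big).$$ -/

import Mathlib

open Filter Asymptotics
open scoped Matrix MatrixOrder ComplexOrder

noncomputable section

namespace SpinErasure

/-! Throughout, a spin `s` is encoded by the natural number `ℓ = 2 * s`. A single site has the
basis `|s, m⟩`, `m = -s, …, s`, labelled by `k : Fin (ℓ + 1)` through `m = k - s`. The space of `N`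
spins is the space of functions on configurations `Fin N → Fin (ℓ + 1)`, with the product basis. -/

/-- The spin `s = ℓ / 2`. -/
def spin (ℓ : ℕ) : ℝ := (ℓ : ℝ) / 2

/-- The magnetic quantum number `m = k - s` of the `k`-th basis state of one site. -/
def mag (ℓ : ℕ) (k : Fin (ℓ + 1)) : ℝ := (k : ℝ) - spin ℓ

/-- The coefficient `c⁺ = √((J - M) (J + M + 1))`. -/
def cPlus (J M : ℝ) : ℝ := Real.sqrt ((J - M) * (J + M + 1))

/-- The coefficient `c⁻ = √((J + M) (J - M + 1))`. -/
def cMinus (J M : ℝ) : ℝ := Real.sqrt ((J + M) * (J - M + 1))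

/-- The one-site operator `q^z`, with `q^z |s, m⟩ = m |s, m⟩`. -/
def qZ (ℓ : ℕ) : Matrix (Fin (ℓ + 1)) (Fin (ℓ + 1)) ℂ :=
  Matrix.diagonal fun k => (mag ℓ k : ℂ)

/-- The one-site operator `q⁺`, with `q⁺ |s, m⟩ = √((s - m) (s + m + 1)) |s, m + 1⟩`. -/
def qPlus (ℓ : ℕ) : Matrix (Fin (ℓ + 1)) (Fin (ℓ + 1)) ℂ :=
  Matrix.of fun k' k => if (k' : ℕ) = (k : ℕ) + 1 then (cPlus (spin ℓ) (mag ℓ k) : ℂ) else 0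

/-- The one-site operator `q⁻`, with `q⁻ |s, m⟩ = √((s + m) (s - m + 1)) |s, m - 1⟩`. -/
def qMinus (ℓ : ℕ) : Matrix (Fin (ℓ + 1)) (Fin (ℓ + 1)) ℂ :=
  Matrix.of fun k' k => if (k' : ℕ) + 1 = (k : ℕ) then (cMinus (spin ℓ) (mag ℓ k) : ℂ) else 0

/-- Configurations of the sites in `ι`, i.e. labels of the product basis. -/
abbrev Config (ℓ : ℕ) (ι : Type) : Type := ι → Fin (ℓ + 1)

/-- The sum over all sites `j` of the operator `q` acting on site `j` (and as the identity on the
other sites). -/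
def total {ℓ N : ℕ} (q : Matrix (Fin (ℓ + 1)) (Fin (ℓ + 1)) ℂ) :
    Matrix (Config ℓ (Fin N)) (Config ℓ (Fin N)) ℂ :=
  ∑ j : Fin N, Matrix.of fun x y => if ∀ i, i ≠ j → x i = y i then q (x j) (y j) else 0

/-- `ψ M = |J, M⟩`, `M = -J, …, J`, is a standard basis of a spin-`J` irreducible representation of
`SU(2)` (`J` an integer) inside the space of `N` spins `ℓ / 2`: unit vectors on which the total spin
operators `Q^z`, `Q⁺`, `Q⁻` act in the standard way. At `M = J` and `M = -J` the coefficients `c⁺`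
and `c⁻` vanish, so that values of `ψ` outside `-J, …, J` do not matter. -/
structure IsIrrepBasis (ℓ N J : ℕ) (ψ : ℤ → Config ℓ (Fin N) → ℂ) : Prop where
  unit : ∀ M : ℤ, |M| ≤ J → star (ψ M) ⬝ᵥ ψ M = 1
  z : ∀ M : ℤ, |M| ≤ J → total (qZ ℓ) *ᵥ ψ M = (M : ℂ) • ψ M
  plus : ∀ M : ℤ, |M| ≤ J → total (qPlus ℓ) *ᵥ ψ M = (cPlus J M : ℂ) • ψ (M + 1)
  minus : ∀ M : ℤ, |M| ≤ J → total (qMinus ℓ) *ᵥ ψ M = (cMinus J M : ℂ) • ψ (M - 1)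

/-- The configuration of all `N` sites that is `x` on `α` and `z` on the complement of `α`. -/
def glue {ℓ N : ℕ} {α : Finset (Fin N)} (x : Config ℓ {i // i ∈ α}) (z : Config ℓ {i // i ∉ α}) :
    Config ℓ (Fin N) :=
  fun i => if h : i ∈ α then x ⟨i, h⟩ else z ⟨i, h⟩

/-- The partial trace over the complement of `α`: the reduction of an operator to the sites in
`α`. -/
def traceCompl {ℓ N : ℕ} (α : Finset (Fin N))
    (ρ : Matrix (Config ℓ (Fin N)) (Config ℓ (Fin N)) ℂ) :
    Matrix (Config ℓ {i // i ∈ α}) (Config ℓ {i // i ∈ α}) ℂ :=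
  Matrix.of fun x y => ∑ z : Config ℓ {i // i ∉ α}, ρ (glue x z) (glue y z)

/-- The reduced state on the sites in `α` of the pure state `|ψ⟩⟨ψ|`. -/
def reduced {ℓ N : ℕ} (α : Finset (Fin N)) (ψ : Config ℓ (Fin N) → ℂ) :
    Matrix (Config ℓ {i // i ∈ α}) (Config ℓ {i // i ∈ α}) ℂ :=
  traceCompl α (Matrix.vecMulVec ψ (star ψ))

/-- The trace norm `‖A‖₁ = Tr √(A† A)`. -/
def traceNorm {n : Type} [Fintype n] [DecidableEq n] (A : Matrix n n ℂ) : ℝ :=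
  (Matrix.trace (CFC.sqrt (Aᴴ * A))).re

/-- The fidelity `f(ρ, σ) = ‖√σ √ρ‖₁` of two density matrices. -/
def fidelity {n : Type} [Fintype n] [DecidableEq n] (ρ σ : Matrix n n ℂ) : ℝ :=
  traceNorm (CFC.sqrt σ * CFC.sqrt ρ)

end SpinErasure

end

noncomputable section

namespace SpinErasure

/-! A spin `s = ℓ/2` behaves like the symmetric subspace of `ℓ` qubits, so the spin-`J` irrep with
`J = sN` is the symmetric space of `n = ℓN` qubits, and `|J, M⟩` is the Dicke state with `K = J + M`
excitations. This is forced by the relations: the `Q^z` eigenvalue `J` occurs only at the all-up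
configuration, and lowering from there fixes every other vector (`IsIrrepBasis.eq_dicke`).

Tracing out the complement of `α` leaves a mixture of Dicke states on `α`, with hypergeometric
weights: the number of excitations among `D = ℓd` of the `n` qubits (`reduced_dicke`). The reduced
states for different `M` are diagonal in one common orthonormal family, so their fidelity is the
Bhattacharyya coefficient of two hypergeometric laws, and one minus it is half the squared distance
between the unit vectors of square roots of probabilities.

Moving `K` to `K + 1` changes the probability of `k` by a relative amount whose numerator is nearly
a centred multiple of `k`. Since the variance is at most the mean, the squared distance of one step
is `O(D / n²)` (`sum_sq_sqrt_hypergeom_succ_le`). The triangle inequality over `|M|` steps gives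
`O(D M² / n²)`, which is `O(d M² / (s N²))`. -/

/-- The excitation number `∑ x_i` of a configuration. -/
def weight {ℓ : ℕ} {ι : Type} [Fintype ι] (x : Config ℓ ι) : ℕ := ∑ i, (x i : ℕ)

/-- The product of the binomial coefficients `ℓ.choose x_i`. -/
def multiplicity {ℓ : ℕ} {ι : Type} [Fintype ι] (x : Config ℓ ι) : ℕ := ∏ i, ℓ.choose (x i)

/-- The amplitudes of the Dicke state with `K` excitations. -/
def dicke (ℓ N K : ℕ) (x : Config ℓ (Fin N)) : ℝ :=
  if weight x = K then √(multiplicity x : ℝ) / √((ℓ * N).choose K : ℝ) else 0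

/-! ### Combinatorics of configurations. -/

section Config

variable {ℓ : ℕ} {ι : Type} [Fintype ι]

lemma weight_le (x : Config ℓ ι) : weight x ≤ ℓ * Fintype.card ι := by
  calc weight x ≤ ∑ _i : ι, ℓ := Finset.sum_le_sum fun i _ => by have := (x i).isLt; omega
    _ = _ := by simp [mul_comm]

lemma eq_last_of_weight_eq (x : Config ℓ ι) (h : weight x = ℓ * Fintype.card ι) :
    x = fun _ => Fin.last ℓ := by
  have h' : ∑ i, (x i : ℕ) = ∑ _i : ι, ℓ := by
    rw [← weight, h]; simp [mul_comm]
  have := (Finset.sum_eq_sum_iff_of_le (fun i _ => by have := (x i).isLt; omega)).1 h'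
  funext i
  exact Fin.ext (this i (Finset.mem_univ i))

/-- Generalized Vandermonde identity. -/
lemma sum_multiplicity [DecidableEq ι] (k : ℕ) :
    ∑ x : Config ℓ ι, (if weight x = k then multiplicity x else 0)
      = (ℓ * Fintype.card ι).choose k := by
  have h1 : ((1 + Polynomial.X : Polynomial ℕ) ^ ℓ) =
      ∑ k : Fin (ℓ + 1), Polynomial.C (ℓ.choose k) * Polynomial.X ^ (k : ℕ) := by
    rw [add_comm, add_pow, Finset.sum_range]
    refine Finset.sum_congr rfl fun k _ => ?_
    simp [mul_comm]
  have h2 : ((1 + Polynomial.X : Polynomial ℕ) ^ (ℓ * Fintype.card ι)) =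
      ∑ x : Config ℓ ι, Polynomial.C (multiplicity x) * Polynomial.X ^ weight x := by
    rw [pow_mul, h1]
    have : ∏ _i : ι, (∑ k : Fin (ℓ + 1),
        (Polynomial.C (ℓ.choose k) * Polynomial.X ^ (k : ℕ) : Polynomial ℕ)) = _ :=
      Finset.prod_univ_sum (fun _ => Finset.univ) _
    rw [Finset.prod_const, Finset.card_univ] at this
    rw [this, Fintype.piFinset_univ]
    refine Finset.sum_congr rfl fun x _ => ?_
    rw [Finset.prod_mul_distrib, Finset.prod_pow_eq_pow_sum, weight, multiplicity, map_prod]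
  have h3 := congrArg (fun p => Polynomial.coeff p k) h2
  simp only [Polynomial.coeff_one_add_X_pow, Polynomial.finsetSum_coeff,
    Polynomial.coeff_C_mul_X_pow] at h3
  simp only [Nat.cast_id] at h3
  rw [h3]
  exact Finset.sum_congr rfl fun x _ => if_congr eq_comm rfl rfl

variable [DecidableEq ι]

lemma weight_update (x : Config ℓ ι) (j : ι) (k : Fin (ℓ + 1)) :
    weight (Function.update x j k) + x j = weight x + k := by
  have h : ∀ y : Config ℓ ι, weight y = y j + ∑ i ∈ Finset.univ.erase j, (y i : ℕ) := fun y =>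
    (Finset.add_sum_erase _ _ (Finset.mem_univ j)).symm
  rw [h x, h (Function.update x j k), Function.update_self]
  rw [Finset.sum_congr rfl fun i hi => by rw [Function.update_of_ne (Finset.ne_of_mem_erase hi)]]
  omega

lemma multiplicity_update_succ (x : Config ℓ ι) (j : ι) (k : Fin (ℓ + 1))
    (hk : (x j : ℕ) + 1 = k) :
    multiplicity (Function.update x j k) * k = multiplicity x * (ℓ - x j) := by
  have h : ∀ y : Config ℓ ι, multiplicity y =
      ℓ.choose (y j) * ∏ i ∈ Finset.univ.erase j, ℓ.choose (y i) := fun y =>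
    (Finset.mul_prod_erase _ (fun i => ℓ.choose (y i)) (Finset.mem_univ j)).symm
  rw [h x, h (Function.update x j k), Function.update_self]
  rw [Finset.prod_congr rfl fun i hi => by rw [Function.update_of_ne (Finset.ne_of_mem_erase hi)]]
  have := Nat.choose_succ_right_eq ℓ (x j)
  rw [hk] at this
  rw [mul_right_comm, this, mul_right_comm]

end Config

/-! ### Total spin operators and Dicke states. -/

lemma total_mulVec {ℓ N : ℕ} (q : Matrix (Fin (ℓ + 1)) (Fin (ℓ + 1)) ℂ)
    (v : Config ℓ (Fin N) → ℂ) (x : Config ℓ (Fin N)) :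
    (total q *ᵥ v) x = ∑ j, ∑ k, q (x j) k * v (Function.update x j k) := by
  rw [total, Matrix.sum_mulVec, Finset.sum_apply]
  refine Finset.sum_congr rfl fun j _ => ?_
  simp only [Matrix.mulVec, dotProduct, Matrix.of_apply]
  symm
  -- Row `x` of the `j`-th summand is supported on the configurations that differ from `x` at most
  -- at `j`.
  refine Finset.sum_of_injOn (fun k => Function.update x j k) ?_ ?_ ?_ ?_
  · intro a _ b _ hab
    simpa using congrFun hab j
  · intro a _; simp
  · intro y _ hy
    rw [if_neg, zero_mul]
    intro h
    refine hy ⟨y j, by simp, ?_⟩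
    funext i
    by_cases hi : i = j
    · subst hi; simp
    · simp [hi, h i hi]
  · intro k _
    rw [if_pos, Function.update_self]
    intro i hi
    simp [hi]

lemma total_qZ_mulVec {ℓ N : ℕ} (v : Config ℓ (Fin N) → ℂ) (x : Config ℓ (Fin N)) :
    (total (qZ ℓ) *ᵥ v) x = ((weight x : ℂ) - (ℓ * N : ℕ) / 2) * v x := by
  rw [total_mulVec]
  have : ∀ j, ∑ k, qZ ℓ (x j) k * v (Function.update x j k) = (mag ℓ (x j) : ℂ) * v x := by
    intro j
    rw [Finset.sum_eq_single (x j)]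
    · simp [qZ]
    · intro k _ hk; simp [qZ, Matrix.diagonal_apply_ne _ hk.symm]
    · simp
  simp only [this, ← Finset.sum_mul]
  congr 1
  simp [mag, spin, weight]
  ring

lemma cMinus_mag {ℓ : ℕ} (k : Fin (ℓ + 1)) :
    cMinus (spin ℓ) (mag ℓ k) = √((k : ℝ) * (ℓ - k + 1)) := by
  rw [cMinus, mag, spin]; congr 1; ring

/-- The ladder coefficient times the ratio of the square-rooted multiplicities collapses to the
linear factor `ℓ - x j`, so summing over the sites gives a function of the weight alone. -/
lemma sum_qMinus_dicke {ℓ N K : ℕ} (x : Config ℓ (Fin N)) (j : Fin N) :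
    ∑ k, qMinus ℓ (x j) k * (dicke ℓ N (K + 1) (Function.update x j k) : ℂ) =
      ((if weight x = K then ((ℓ : ℝ) - x j) * (√(multiplicity x : ℝ) /
        √((ℓ * N).choose (K + 1) : ℝ)) else 0 : ℝ) : ℂ) := by
  have hx := (x j).isLt
  rcases Nat.lt_or_ge (x j) ℓ with h | h
  · have hk : ((⟨x j + 1, by omega⟩ : Fin (ℓ + 1)) : ℕ) = x j + 1 := rfl
    generalize (⟨x j + 1, by omega⟩ : Fin (ℓ + 1)) = k at hk
    rw [Finset.sum_eq_single k]
    · have hw := weight_update x j k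
      have hm := multiplicity_update_succ x j k hk.symm
      simp only [qMinus, Matrix.of_apply, hk, if_true, ← Complex.ofReal_mul]
      congr 1
      by_cases hK : weight x = K
      · rw [dicke, if_pos (by omega), if_pos hK, cMinus_mag, ← mul_div_assoc, ← mul_div_assoc]
        congr 1
        have hkr : (k : ℝ) = x j + 1 := by exact_mod_cast hk
        have hl : (x j : ℝ) ≤ ℓ := by exact_mod_cast h.le
        have hm' : (multiplicity (Function.update x j k) : ℝ) * k
            = multiplicity x * (ℓ - x j) := by
          have := congrArg (Nat.cast (R := ℝ)) hm
          push_cast [Nat.cast_sub h.le] at this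
          exact this
        have e : (k : ℝ) * (ℓ - k + 1) * multiplicity (Function.update x j k)
            = (ℓ - x j) ^ 2 * multiplicity x := by
          rw [show (k : ℝ) * (ℓ - k + 1) * multiplicity (Function.update x j k) =
            (multiplicity (Function.update x j k) * k) * (ℓ - k + 1) by ring, hm', hkr]
          ring
        rw [← Real.sqrt_mul, e, Real.sqrt_mul (by positivity), Real.sqrt_sq (by linarith)]
        have : (0 : ℝ) ≤ ℓ - k + 1 := by rw [hkr]; linarith
        positivity
      · rw [dicke, if_neg (by omega), if_neg hK, mul_zero]
    · intro k' _ hk'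
      have : ¬ ((x j : ℕ) + 1 = k') := fun h' => hk' (Fin.ext (by omega))
      simp [qMinus, this]
    · simp
  -- A site at its top level cannot be the image of a lowering; the factor `ℓ - x j` vanishes
  -- accordingly.
  · have h' : (x j : ℕ) = ℓ := by omega
    rw [Finset.sum_eq_zero]
    · simp [h']
    · intro k _
      have : ¬ ((x j : ℕ) + 1 = k) := by have := k.isLt; omega
      simp [qMinus, this]

lemma total_qMinus_dicke {ℓ N K : ℕ} (hK : K < ℓ * N) :
    total (qMinus ℓ) *ᵥ (fun x => (dicke ℓ N (K + 1) x : ℂ)) =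
      (√(((K : ℝ) + 1) * ((ℓ * N : ℕ) - K)) : ℂ) • fun x => (dicke ℓ N K x : ℂ) := by
  funext x
  rw [total_mulVec, Finset.sum_congr rfl fun j _ => sum_qMinus_dicke x j, ← Complex.ofReal_sum,
    Pi.smul_apply, smul_eq_mul, ← Complex.ofReal_mul]
  congr 1
  by_cases h : weight x = K
  · simp only [h, if_true, dicke, ← Finset.sum_mul]
    have hs : ∑ j : Fin N, ((ℓ : ℝ) - x j) = (ℓ * N : ℕ) - K := by
      rw [← h]; simp [weight]; ring
    rw [hs]
    have h0 : (0 : ℝ) < (ℓ * N : ℕ) - K := by rw [sub_pos]; exact_mod_cast hK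
    have hc := Nat.choose_succ_right_eq (ℓ * N) K
    have hc' : ((ℓ * N).choose (K + 1) : ℝ) * (K + 1)
        = (ℓ * N).choose K * ((ℓ * N : ℕ) - K) := by
      have := congrArg (Nat.cast (R := ℝ)) hc
      rw [Nat.cast_mul, Nat.cast_mul, Nat.cast_sub hK.le] at this
      exact_mod_cast this
    have p1 : (0 : ℝ) < (ℓ * N).choose (K + 1) := by exact_mod_cast Nat.choose_pos hK
    have p0 : (0 : ℝ) < (ℓ * N).choose K := by exact_mod_cast Nat.choose_pos hK.le
    have s1 : (0 : ℝ) < √((ℓ * N).choose (K + 1) : ℝ) := Real.sqrt_pos.2 p1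
    have s0 : (0 : ℝ) < √((ℓ * N).choose K : ℝ) := Real.sqrt_pos.2 p0
    have key : ((ℓ * N : ℕ) - (K : ℝ)) * √((ℓ * N).choose K : ℝ) =
        √(((K : ℝ) + 1) * ((ℓ * N : ℕ) - K)) * √((ℓ * N).choose (K + 1) : ℝ) := by
      rw [← Real.sqrt_mul (by positivity), show ((K : ℝ) + 1) * ((ℓ * N : ℕ) - K) *
        (ℓ * N).choose (K + 1) = ((ℓ * N : ℕ) - (K : ℝ)) ^ 2 * (ℓ * N).choose K by
          linear_combination ((ℓ * N : ℕ) - (K : ℝ)) * hc']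
      rw [Real.sqrt_mul (by positivity), Real.sqrt_sq h0.le]
    generalize √(((K : ℝ) + 1) * ((ℓ * N : ℕ) - K)) = r at key ⊢
    field_simp
    linear_combination √(multiplicity x : ℝ) * key
  · simp [h, dicke]

/-- Uniqueness of the maximal-spin irrep: its basis states are the Dicke states, up to a common
phase. -/
theorem IsIrrepBasis.eq_dicke {ℓ N J : ℕ} (hJ : 2 * J = ℓ * N)
    {ψ : ℤ → Config ℓ (Fin N) → ℂ} (h : IsIrrepBasis ℓ N J ψ) :
    ∃ c : ℂ, c * star c = 1 ∧ ∀ K : ℕ, K ≤ ℓ * N →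
      ψ ((K : ℤ) - J) = c • fun x => (dicke ℓ N K x : ℂ) := by
  set top : Config ℓ (Fin N) := fun _ => Fin.last ℓ with htop
  have hJc : ((ℓ * N : ℕ) : ℂ) = 2 * J := by rw [← hJ]; push_cast; rfl
  have hJr : ((ℓ * N : ℕ) : ℝ) = 2 * J := by rw [← hJ]; push_cast; rfl
  have hsupp : ∀ x, x ≠ top → ψ J x = 0 := by
    intro x hx
    have hz := congrFun (h.z J (by simp)) x
    rw [total_qZ_mulVec, Pi.smul_apply, smul_eq_mul, hJc] at hz
    have hw : weight x ≠ 2 * J := fun hw => hx (eq_last_of_weight_eq x (by simp [hw, hJ]))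
    have hw' : (weight x : ℂ) - 2 * J ≠ 0 := sub_ne_zero.2 (by exact_mod_cast hw)
    have : ((weight x : ℂ) - 2 * J) * ψ J x = 0 := by
      push_cast at hz
      linear_combination hz
    exact (mul_eq_zero.1 this).resolve_left hw'
  have hdt : ∀ x, dicke ℓ N (ℓ * N) x = if x = top then 1 else 0 := by
    intro x
    rw [dicke]
    by_cases hx : x = top
    · have : weight x = ℓ * N := by rw [hx]; simp [weight, htop, mul_comm]
      rw [if_pos this, if_pos hx, hx]; simp [multiplicity, htop]
    · rw [if_neg hx, if_neg]
      intro hw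
      exact hx (eq_last_of_weight_eq x (by simp [hw]))
  refine ⟨ψ J top, ?_, ?_⟩
  · have hu := h.unit J (by simp)
    rw [dotProduct, Finset.sum_eq_single top] at hu
    · rw [mul_comm]; exact hu
    · intro x _ hx; simp [hsupp x hx]
    · simp
  · intro K hK
    induction hK using Nat.decreasingInduction with
    | self =>
      funext x
      have e : (((ℓ * N : ℕ) : ℤ) - J) = J := by omega
      rw [e, Pi.smul_apply, hdt]
      by_cases hx : x = top
      · simp [hx]
      · simp [hx, hsupp x hx]
    | of_succ K hK ih =>
      have hm := h.minus (((K + 1 : ℕ) : ℤ) - J) (by rw [abs_le]; omega)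
      rw [ih, Matrix.mulVec_smul, total_qMinus_dicke hK] at hm
      have e : (((K + 1 : ℕ) : ℤ) - J) - 1 = K - J := by push_cast; ring
      have ec : cMinus (J : ℝ) ((((K + 1 : ℕ) : ℤ) - J : ℤ) : ℝ)
          = √(((K : ℝ) + 1) * ((ℓ * N : ℕ) - K)) := by
        rw [cMinus, hJr]; congr 1; push_cast; ring
      rw [e, ec, smul_comm] at hm
      -- The lowering coefficient is nonzero below the top, so it can be cancelled and the phase
      -- stays the same.
      have h0 : (0 : ℝ) < (ℓ * N : ℕ) - K := by rw [sub_pos]; exact_mod_cast hK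
      have hne : (√(((K : ℝ) + 1) * ((ℓ * N : ℕ) - K)) : ℂ) ≠ 0 := by
        rw [Complex.ofReal_ne_zero]
        exact (Real.sqrt_pos.2 (by positivity)).ne'
      exact (smul_right_injective _ hne hm).symm

/-! ### Moments of the hypergeometric distribution. -/

/-- The hypergeometric distribution: `K` draws from `n` items, `D` of which are marked. -/
def hypergeom (n D K k : ℕ) : ℝ :=
  (D.choose k : ℝ) * ((n - D).choose (K - k) : ℝ) / (n.choose K : ℝ)

lemma hypergeom_nonneg (n D K k : ℕ) : 0 ≤ hypergeom n D K k := by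
  unfold hypergeom; positivity

/-- Factorial moments of the hypergeometric distribution. -/
lemma sum_descFactorial_choose {n D K r : ℕ} (hn : D ≤ n) (hK : D ≤ K) (hr : r ≤ D) :
    ∑ k ∈ Finset.range (D + 1), k.descFactorial r * (D.choose k * (n - D).choose (K - k))
      = D.descFactorial r * (n - r).choose (K - r) := by
  -- Absorption moves the falling factorial from `k` to `D`; Vandermonde then evaluates the
  -- remaining sum.
  have h1 : ∀ k ∈ Finset.range (D + 1), k.descFactorial r * (D.choose k * (n - D).choose (K - k))
      = if r ≤ k then D.descFactorial r *
        ((D - r).choose (k - r) * (n - D).choose (K - k)) else 0 := by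
    intro k hk
    have hk : k ≤ D := by simpa [Nat.lt_succ_iff] using hk
    split_ifs with h
    · have := Nat.choose_mul (n := D) h
      rw [← mul_assoc, ← mul_assoc, Nat.descFactorial_eq_factorial_mul_choose,
        Nat.descFactorial_eq_factorial_mul_choose, mul_assoc r.factorial, mul_assoc r.factorial,
        mul_comm (k.choose r), this]
      ring
    · rw [Nat.descFactorial_eq_zero_iff_lt.2 (by omega), zero_mul]
  rw [Finset.sum_congr rfl h1, ← Finset.sum_filter]
  have hf : (Finset.range (D + 1)).filter (fun k => r ≤ k) = Finset.Ico r (D + 1) := by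
    ext k; simp; omega
  rw [hf, Finset.sum_Ico_eq_sum_range, ← Finset.mul_sum]
  congr 1
  have e : n - r = (D - r) + (n - D) := by omega
  rw [e, Nat.add_choose_eq, Finset.Nat.sum_antidiagonal_eq_sum_range_succ_mk]
  have hsub : Finset.range (D + 1 - r) ⊆ Finset.range (K - r).succ := by
    intro i; simp; omega
  rw [← Finset.sum_subset hsub]
  · refine Finset.sum_congr rfl fun i _ => ?_
    rw [Nat.add_sub_cancel_left, Nat.sub_sub]
  · intro i _ hi
    have : D - r < i := by simp at hi; omega
    simp [Nat.choose_eq_zero_of_lt this]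

lemma sum_hypergeom_mul_descFactorial {n D K r : ℕ} (hn : K ≤ n) (hK : D ≤ K) (hr : r ≤ D) :
    ∑ k ∈ Finset.range (D + 1), hypergeom n D K k * k.descFactorial r
      = D.descFactorial r * K.descFactorial r / n.descFactorial r := by
  have hc : (0 : ℝ) < n.choose K := by exact_mod_cast Nat.choose_pos hn
  have hd : (0 : ℝ) < n.descFactorial r := by
    exact_mod_cast Nat.descFactorial_pos.2 (by omega)
  have h := congrArg (Nat.cast (R := ℝ)) (sum_descFactorial_choose (n := n) (by omega) hK hr)
  push_cast at h
  have hch : (n.choose K : ℝ) * K.descFactorial r = n.descFactorial r * (n - r).choose (K - r) := by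
    have := Nat.choose_mul (n := n) (hr.trans hK)
    rw [Nat.descFactorial_eq_factorial_mul_choose, Nat.descFactorial_eq_factorial_mul_choose]
    have := congrArg (Nat.cast (R := ℝ)) this
    push_cast at this ⊢
    linear_combination (r.factorial : ℝ) * this
  rw [eq_div_iff hd.ne']
  have : ∑ k ∈ Finset.range (D + 1), hypergeom n D K k * k.descFactorial r
      = (D.descFactorial r * (n - r).choose (K - r)) / n.choose K := by
    rw [← h, Finset.sum_div]
    refine Finset.sum_congr rfl fun k _ => ?_
    rw [hypergeom]; ring
  rw [this, div_mul_eq_mul_div, div_eq_iff hc.ne']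
  linear_combination -(D.descFactorial r : ℝ) * hch

lemma sum_hypergeom {n D K : ℕ} (hn : K ≤ n) (hK : D ≤ K) :
    ∑ k ∈ Finset.range (D + 1), hypergeom n D K k = 1 := by
  simpa using sum_hypergeom_mul_descFactorial hn hK (Nat.zero_le D)

lemma sum_hypergeom_mul {n D K : ℕ} (hn : K ≤ n) (hK : D ≤ K) :
    ∑ k ∈ Finset.range (D + 1), hypergeom n D K k * k = D * K / n := by
  rcases Nat.eq_zero_or_pos D with rfl | hD
  · simp
  · simpa using sum_hypergeom_mul_descFactorial hn hK hD

/-- Equivalently, the variance is at most the mean, because the second factorial moment is at most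
the squared mean. The factorial moment formula needs `2 ≤ D`; for smaller `D`, `k ^ 2 = k`. -/
lemma sum_hypergeom_mul_sq_le {n D K : ℕ} (hn : K ≤ n) (hK : D ≤ K) :
    ∑ k ∈ Finset.range (D + 1), hypergeom n D K k * (k : ℝ) ^ 2
      ≤ (D * K / n) ^ 2 + D * K / n := by
  rcases Nat.lt_or_ge D 2 with hD | hD
  · have : ∀ k ∈ Finset.range (D + 1), hypergeom n D K k * (k : ℝ) ^ 2
        = hypergeom n D K k * k := by
      intro k hk
      have : k < 2 := by simp at hk; omega
      interval_cases k <;> simp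
    rw [Finset.sum_congr rfl this, sum_hypergeom_mul hn hK]
    nlinarith [sq_nonneg ((D * K / n : ℝ))]
  · have h2 := sum_hypergeom_mul_descFactorial hn hK hD
    have h1 := sum_hypergeom_mul hn hK
    have : ∀ k ∈ Finset.range (D + 1), hypergeom n D K k * (k : ℝ) ^ 2
        = hypergeom n D K k * k.descFactorial 2 + hypergeom n D K k * k := by
      intro k _
      rw [Nat.cast_descFactorial_two]; ring
    rw [Finset.sum_congr rfl this, Finset.sum_add_distrib, h1, h2]
    gcongr
    simp only [Nat.cast_descFactorial_two]
    have hDr : (2 : ℝ) ≤ D := by exact_mod_cast hD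
    have hKr : (D : ℝ) ≤ K := by exact_mod_cast hK
    have hnr : (K : ℝ) ≤ n := by exact_mod_cast hn
    have a1 : ((D : ℝ) - 1) / (n - 1) ≤ D / n := by
      rw [div_le_div_iff₀ (by linarith) (by linarith)]; nlinarith
    have a2 : (K : ℝ) * (K - 1) ≤ K ^ 2 := by nlinarith
    calc (D : ℝ) * (D - 1) * (K * (K - 1)) / (n * (n - 1))
        = (D / n) * ((D - 1) / (n - 1)) * (K * (K - 1)) := by
          have : (n : ℝ) - 1 ≠ 0 := by intro h; linarith
          have : (n : ℝ) ≠ 0 := by intro h; linarith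
          field_simp
      _ ≤ (D / n) * (D / n) * K ^ 2 := by
          have : (0 : ℝ) ≤ K * (K - 1) := mul_nonneg (by linarith) (by linarith)
          gcongr
      _ = (D * K / n) ^ 2 := by ring

/-! ### Hellinger distance between hypergeometric laws. -/

/-- The ratio of consecutive probabilities is rational in `k`. The numerator of the relative
increment vanishes at `(K + 1) D / (n + 1)`, close to the mean `D K / n`, which makes its second
moment small. -/
lemma hypergeom_succ_sub {n D K k : ℕ} (hk : k ≤ D) (hK : D ≤ K) (hn : K + D < n) :
    hypergeom n D (K + 1) k - hypergeom n D K k = hypergeom n D K k *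
      ((k * (n + 1) - (K + 1) * D) / ((K + 1 - k) * (n - K))) := by
  have h1 : ((n.choose (K + 1) : ℕ) : ℝ) * (K + 1) = n.choose K * (n - K) := by
    have := congrArg (Nat.cast (R := ℝ)) (Nat.choose_succ_right_eq n K)
    push_cast [Nat.cast_sub (show K ≤ n by omega)] at this
    exact this
  have h2 : ((n - D).choose (K + 1 - k) : ℝ) * (K + 1 - k)
      = (n - D).choose (K - k) * (n - D - (K - k)) := by
    have := congrArg (Nat.cast (R := ℝ)) (Nat.choose_succ_right_eq (n - D) (K - k))
    rw [show K - k + 1 = K + 1 - k by omega] at this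
    push_cast [Nat.cast_sub (show k ≤ K by omega), Nat.cast_sub (show k ≤ K + 1 by omega),
      Nat.cast_sub (show D ≤ n by omega), Nat.cast_sub (show K - k ≤ n - D by omega)] at this
    exact this
  have p1 : (0 : ℝ) < n.choose (K + 1) := by exact_mod_cast Nat.choose_pos (by omega)
  have p0 : (0 : ℝ) < n.choose K := by exact_mod_cast Nat.choose_pos (by omega)
  have hKk : (0 : ℝ) < K + 1 - k := by
    have : (k : ℝ) ≤ K := by exact_mod_cast hk.trans hK
    linarith
  have hnK : (0 : ℝ) < n - K := by
    rw [sub_pos]; exact_mod_cast (show K < n by omega)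
  have e1 : (n.choose (K + 1) : ℝ) = n.choose K * (n - K) / (K + 1) := by
    rw [eq_div_iff (by positivity)]; exact h1
  have e2 : ((n - D).choose (K + 1 - k) : ℝ)
      = (n - D).choose (K - k) * (n - D - (K - k)) / (K + 1 - k) := by
    rw [eq_div_iff hKk.ne']; exact h2
  rw [hypergeom, hypergeom, e1, e2]
  have : (K : ℝ) + 1 ≠ 0 := by positivity
  field_simp
  ring

/-- Multiply by `(√p + √q) ^ 2 ≥ q` and use `(√p - √q)(√p + √q) = p - q`. -/
lemma sq_sqrt_sub_sqrt_le {p q r : ℝ} (hp : 0 ≤ p) (hq : 0 ≤ q) (h : p - q = q * r) :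
    (√p - √q) ^ 2 ≤ q * r ^ 2 := by
  rcases hq.eq_or_lt with rfl | hq'
  · have : p = 0 := by simpa using h
    simp [this]
  · have h1 : (√p - √q) * (√p + √q) = q * r := by
      rw [← h]; nlinarith [Real.sq_sqrt hp, Real.sq_sqrt hq]
    have hs : 0 < √q := Real.sqrt_pos.2 hq'
    have h2 : q ≤ (√p + √q) ^ 2 := by nlinarith [Real.sq_sqrt hq, Real.sqrt_nonneg p]
    have h3 : (√p - √q) ^ 2 * q ≤ q * r ^ 2 * q := by
      calc (√p - √q) ^ 2 * q ≤ (√p - √q) ^ 2 * (√p + √q) ^ 2 := by gcongr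
        _ = (q * r) ^ 2 := by rw [← h1]; ring
        _ = _ := by ring
    exact le_of_mul_le_mul_right h3 hq'

/-- The squared Hellinger distance of hypergeometric distributions with consecutive numbers of
draws. -/
lemma sum_sq_sqrt_hypergeom_succ_le {n D K : ℕ} (hn : 0 < n) (hD : 8 * D ≤ n)
    (hK : 3 * n ≤ 8 * K) (hK' : 8 * K ≤ 5 * n) :
    ∑ k ∈ Finset.range (D + 1), (√(hypergeom n D (K + 1) k) - √(hypergeom n D K k)) ^ 2
      ≤ 1280 * D / n ^ 2 := by
  have hDK : D ≤ K := by omega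
  have hKn : K ≤ n := by omega
  have hnr : (1 : ℝ) ≤ n := by exact_mod_cast hn
  have hDr : 8 * (D : ℝ) ≤ n := by exact_mod_cast hD
  have hKr : 3 * (n : ℝ) ≤ 8 * K := by exact_mod_cast hK
  have hKr' : 8 * (K : ℝ) ≤ 5 * n := by exact_mod_cast hK'
  have hD0 : (0 : ℝ) ≤ D := D.cast_nonneg
  have step : ∀ k ∈ Finset.range (D + 1),
      (√(hypergeom n D (K + 1) k) - √(hypergeom n D K k)) ^ 2
      ≤ 256 / n ^ 4 * (hypergeom n D K k * ((n + 1) ^ 2 * k ^ 2)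
        - 2 * (n + 1) * ((K + 1) * D) * (hypergeom n D K k * k)
        + ((K + 1) * D) ^ 2 * hypergeom n D K k) := by
    intro k hk
    have hk : k ≤ D := by simpa [Nat.lt_succ_iff] using hk
    refine (sq_sqrt_sub_sqrt_le (hypergeom_nonneg _ _ _ _) (hypergeom_nonneg _ _ _ _)
      (hypergeom_succ_sub hk hDK (by omega))).trans ?_
    have hkr : (k : ℝ) ≤ D := by exact_mod_cast hk
    -- With `K` between `3n/8` and `5n/8` and `k ≤ n/8`, both factors are at least `n/4`; squaring
    -- yields the constant 256.
    have hden : (n : ℝ) ^ 2 / 16 ≤ (K + 1 - k) * (n - K) := by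
      have a : (n : ℝ) / 4 ≤ K + 1 - k := by linarith
      have b : (n : ℝ) / 4 ≤ n - K := by linarith
      calc (n : ℝ) ^ 2 / 16 = n / 4 * (n / 4) := by ring
        _ ≤ _ := by gcongr; linarith
    have hr : (((k : ℝ) * (n + 1) - (K + 1) * D) / ((K + 1 - k) * (n - K))) ^ 2
        ≤ 256 / n ^ 4 * (k * (n + 1) - (K + 1) * D) ^ 2 := by
      rw [div_pow]
      calc _ ≤ ((k : ℝ) * (n + 1) - (K + 1) * D) ^ 2 / ((n : ℝ) ^ 2 / 16) ^ 2 := by gcongr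
        _ = _ := by field_simp; ring
    calc _ ≤ hypergeom n D K k * (256 / n ^ 4 * (k * (n + 1) - (K + 1) * D) ^ 2) :=
          mul_le_mul_of_nonneg_left hr (hypergeom_nonneg _ _ _ _)
      _ = _ := by ring
  refine (Finset.sum_le_sum step).trans ?_
  rw [← Finset.mul_sum, Finset.sum_add_distrib, Finset.sum_sub_distrib, ← Finset.mul_sum,
    ← Finset.mul_sum, sum_hypergeom hKn hDK, sum_hypergeom_mul hKn hDK]
  have e : ∑ k ∈ Finset.range (D + 1), hypergeom n D K k * (((n : ℝ) + 1) ^ 2 * k ^ 2)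
      = (n + 1) ^ 2 * ∑ k ∈ Finset.range (D + 1), hypergeom n D K k * (k : ℝ) ^ 2 := by
    rw [Finset.mul_sum]; exact Finset.sum_congr rfl fun k _ => by ring
  rw [e]
  have hsq := sum_hypergeom_mul_sq_le hKn hDK
  set μ : ℝ := D * K / n with hμ
  have hμ0 : 0 ≤ μ := by positivity
  have hμn : μ * n = D * K := by rw [hμ]; field_simp
  have hμD : μ ≤ D := by
    rw [hμ, div_le_iff₀ (by linarith)]; nlinarith
  have main : ((n : ℝ) + 1) ^ 2 * ∑ k ∈ Finset.range (D + 1), hypergeom n D K k * (k : ℝ) ^ 2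
      - 2 * (n + 1) * ((K + 1) * D) * μ + ((K + 1) * D) ^ 2 * 1 ≤ 5 * n ^ 2 * D := by
    have a : ((n : ℝ) + 1) ^ 2 * ∑ k ∈ Finset.range (D + 1), hypergeom n D K k * (k : ℝ) ^ 2
        ≤ (n + 1) ^ 2 * (μ ^ 2 + μ) := by gcongr
    -- Since `μ n = D K`, the offset `(n + 1) μ - (K + 1) D` equals `μ - D`. The two terms are then
    -- bounded by `4 n² D` and `n² D`, whence the 5 and `1280 = 256 * 5`.
    have b : ((n : ℝ) + 1) ^ 2 * (μ ^ 2 + μ) - 2 * (n + 1) * ((K + 1) * D) * μ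
        + ((K + 1) * D) ^ 2 * 1 = (n + 1) ^ 2 * μ + (D - μ) ^ 2 := by
      linear_combination ((μ * n - D * K) + 2 * μ - 2 * D) * hμn
    have c : ((n : ℝ) + 1) ^ 2 * μ ≤ (2 * n) ^ 2 * D := by gcongr; linarith
    have d : ((D : ℝ) - μ) ^ 2 ≤ n ^ 2 * D := by
      calc ((D : ℝ) - μ) ^ 2 ≤ D ^ 2 := by gcongr; linarith
        _ = (D : ℝ) * D := sq _
        _ ≤ (n : ℝ) ^ 2 * D := by gcongr; nlinarith
    linarith
  calc _ ≤ 256 / (n : ℝ) ^ 4 * (5 * n ^ 2 * D) := by gcongr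
    _ = _ := by field_simp; ring

/-- The amplitude vector `√p` of the hypergeometric distribution. -/
def hypergeomVec (n D K : ℕ) : EuclideanSpace ℝ (Fin (D + 1)) :=
  WithLp.toLp 2 fun k => √(hypergeom n D K k)

lemma dist_hypergeomVec_succ_le {n D K : ℕ} (hn : 0 < n) (hD : 8 * D ≤ n)
    (hK : 3 * n ≤ 8 * K) (hK' : 8 * K ≤ 5 * n) :
    dist (hypergeomVec n D K) (hypergeomVec n D (K + 1)) ≤ √(1280 * D / n ^ 2) := by
  rw [dist_comm, EuclideanSpace.dist_eq]
  refine Real.sqrt_le_sqrt ?_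
  have := sum_sq_sqrt_hypergeom_succ_le hn hD hK hK'
  rw [Finset.sum_range] at this
  simpa [hypergeomVec, Real.dist_eq, sq_abs] using this

lemma dist_hypergeomVec_le {n D K t : ℕ} (hn : 0 < n) (hD : 8 * D ≤ n)
    (hK : 3 * n ≤ 8 * K) (hK' : 8 * (K + t) ≤ 5 * n) :
    dist (hypergeomVec n D K) (hypergeomVec n D (K + t)) ≤ t * √(1280 * D / n ^ 2) := by
  induction t with
  | zero => simp
  | succ t ih =>
    have h1 := ih (by omega)
    have h2 := dist_hypergeomVec_succ_le (K := K + t) hn hD (by omega) (by omega)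
    have h3 := dist_triangle (hypergeomVec n D K) (hypergeomVec n D (K + t))
      (hypergeomVec n D (K + t + 1))
    push_cast
    rw [← add_assoc]
    linarith

/-- Bhattacharyya coefficients and Hellinger distances. -/
lemma one_sub_sum_sqrt_eq {n D K L : ℕ} (hK : K ≤ n) (hL : L ≤ n) (hDK : D ≤ K) (hDL : D ≤ L) :
    1 - ∑ k : Fin (D + 1), √(hypergeom n D K k) * √(hypergeom n D L k)
      = dist (hypergeomVec n D K) (hypergeomVec n D L) ^ 2 / 2 := by
  have h1 := sum_hypergeom hK hDK
  have h2 := sum_hypergeom hL hDL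
  rw [Finset.sum_range] at h1 h2
  rw [EuclideanSpace.dist_eq, Real.sq_sqrt (by positivity)]
  have : ∀ k : Fin (D + 1), dist (hypergeomVec n D K k) (hypergeomVec n D L k) ^ 2 =
      hypergeom n D K k + hypergeom n D L k
        - 2 * (√(hypergeom n D K k) * √(hypergeom n D L k)) := by
    intro k
    rw [Real.dist_eq, sq_abs, hypergeomVec, hypergeomVec]
    have a := Real.sq_sqrt (hypergeom_nonneg n D K k)
    have b := Real.sq_sqrt (hypergeom_nonneg n D L k)
    linear_combination a + b
  rw [Finset.sum_congr rfl fun k _ => this k, Finset.sum_sub_distrib, Finset.sum_add_distrib,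
    h1, h2, ← Finset.mul_sum]
  ring

theorem abs_one_sub_sum_sqrt_hypergeom_le {n D K L t : ℕ} (hn : 0 < n) (hD : 8 * D ≤ n)
    (hK : 3 * n ≤ 8 * K) (hK' : 8 * K ≤ 5 * n) (hL : 3 * n ≤ 8 * L) (hL' : 8 * L ≤ 5 * n)
    (h : K = L + t ∨ L = K + t) :
    |1 - ∑ k : Fin (D + 1), √(hypergeom n D K k) * √(hypergeom n D L k)|
      ≤ 640 * (D * t ^ 2 / n ^ 2) := by
  rw [one_sub_sum_sqrt_eq (by omega) (by omega) (by omega) (by omega), abs_of_nonneg (by positivity)]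
  have hd : dist (hypergeomVec n D K) (hypergeomVec n D L) ≤ t * √(1280 * D / n ^ 2) := by
    rcases h with rfl | rfl
    · rw [dist_comm]; exact dist_hypergeomVec_le hn hD hL hK'
    · exact dist_hypergeomVec_le hn hD hK hL'
  calc _ ≤ (t * √(1280 * D / n ^ 2)) ^ 2 / 2 := by gcongr
    _ = _ := by rw [mul_pow, Real.sq_sqrt (by positivity)]; ring

/-! ### Fidelity of simultaneously diagonal states. -/

section Fidelity

variable {n m : Type} [Fintype n] [Fintype m] [DecidableEq m]

lemma conj_diagonal_mul {V : Matrix n m ℂ} (hV : Vᴴ * V = 1) (p q : m → ℝ) :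
    (V * Matrix.diagonal (fun k => (p k : ℂ)) * Vᴴ) *
      (V * Matrix.diagonal (fun k => (q k : ℂ)) * Vᴴ)
      = V * Matrix.diagonal (fun k => ((p k * q k : ℝ) : ℂ)) * Vᴴ := by
  calc _ = V * Matrix.diagonal (fun k => (p k : ℂ)) * (Vᴴ * V) *
        Matrix.diagonal (fun k => (q k : ℂ)) * Vᴴ := by simp only [Matrix.mul_assoc]
    _ = _ := by
      rw [hV, Matrix.mul_one, Matrix.mul_assoc V, Matrix.diagonal_mul_diagonal]
      simp

lemma conj_diagonal_nonneg (V : Matrix n m ℂ) {p : m → ℝ} (hp : ∀ k, 0 ≤ p k) :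
    0 ≤ V * Matrix.diagonal (fun k => (p k : ℂ)) * Vᴴ := by
  rw [Matrix.nonneg_iff_posSemidef]
  refine Matrix.PosSemidef.mul_mul_conjTranspose_same ?_ V
  exact Matrix.PosSemidef.diagonal fun k => by simpa using hp k

lemma sqrt_conj_diagonal [DecidableEq n] {V : Matrix n m ℂ} (hV : Vᴴ * V = 1) {p : m → ℝ} (hp : ∀ k, 0 ≤ p k) :
    CFC.sqrt (V * Matrix.diagonal (fun k => (p k : ℂ)) * Vᴴ)
      = V * Matrix.diagonal (fun k => (√(p k) : ℂ)) * Vᴴ := by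
  refine CFC.sqrt_unique ?_ (conj_diagonal_nonneg V fun k => Real.sqrt_nonneg _)
  rw [conj_diagonal_mul hV]
  simp [Real.mul_self_sqrt (hp _)]

/-- The fidelity of two states that are diagonal in the same orthonormal family. -/
lemma fidelity_conj_diagonal [DecidableEq n] {V : Matrix n m ℂ} (hV : Vᴴ * V = 1) {p q : m → ℝ}
    (hp : ∀ k, 0 ≤ p k) (hq : ∀ k, 0 ≤ q k) :
    fidelity (V * Matrix.diagonal (fun k => (p k : ℂ)) * Vᴴ)
      (V * Matrix.diagonal (fun k => (q k : ℂ)) * Vᴴ) = ∑ k, √(p k) * √(q k) := by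
  have hA : ∀ r : m → ℝ, (V * Matrix.diagonal (fun k => (r k : ℂ)) * Vᴴ)ᴴ
      = V * Matrix.diagonal (fun k => (r k : ℂ)) * Vᴴ := by
    intro r
    rw [Matrix.conjTranspose_mul, Matrix.conjTranspose_mul, Matrix.conjTranspose_conjTranspose,
      Matrix.diagonal_conjTranspose, Matrix.mul_assoc]
    congr 3
    funext k
    simp
  rw [fidelity, traceNorm, sqrt_conj_diagonal hV hp, sqrt_conj_diagonal hV hq,
    conj_diagonal_mul hV, hA, conj_diagonal_mul hV,
    sqrt_conj_diagonal hV (fun k => mul_self_nonneg _), Matrix.trace_mul_cycle, hV, Matrix.one_mul,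
    Matrix.trace_diagonal, ← Complex.ofReal_sum, Complex.ofReal_re]
  refine Finset.sum_congr rfl fun k _ => ?_
  rw [Real.sqrt_mul_self (by positivity), mul_comm]

end Fidelity

/-! ### Reduced states of Dicke states. -/

/-- The matrix whose columns are the Dicke states on the sites in `ι`. -/
def dickeIsometry (ℓ : ℕ) (ι : Type) [Fintype ι] :
    Matrix (Config ℓ ι) (Fin (ℓ * Fintype.card ι + 1)) ℂ :=
  Matrix.of fun x k => if weight x = k then
    ((√(multiplicity x : ℝ) / √((ℓ * Fintype.card ι).choose k : ℝ) : ℝ) : ℂ) else 0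

lemma dickeIsometry_conjTranspose_mul_self (ℓ : ℕ) (ι : Type) [Fintype ι] [DecidableEq ι] :
    (dickeIsometry ℓ ι)ᴴ * dickeIsometry ℓ ι = 1 := by
  ext k k'
  rw [Matrix.mul_apply, Matrix.one_apply]
  simp only [Matrix.conjTranspose_apply, dickeIsometry, Matrix.of_apply]
  split_ifs with h
  · subst h
    have hk : 0 < ((ℓ * Fintype.card ι).choose k : ℝ) := by
      exact_mod_cast Nat.choose_pos (by have := k.isLt; omega)
    have hs := congrArg (Nat.cast (R := ℝ)) (sum_multiplicity (ℓ := ℓ) (ι := ι) k)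
    push_cast at hs
    have : ∀ x : Config ℓ ι, star (if weight x = k then
        ((√(multiplicity x : ℝ) / √((ℓ * Fintype.card ι).choose k : ℝ) : ℝ) : ℂ) else 0) *
        (if weight x = k then
        ((√(multiplicity x : ℝ) / √((ℓ * Fintype.card ι).choose k : ℝ) : ℝ) : ℂ) else 0)
        = (((if weight x = k then (multiplicity x : ℝ) else 0) /
          (ℓ * Fintype.card ι).choose k : ℝ) : ℂ) := by
      intro x
      split_ifs
      · rw [RCLike.star_def, Complex.conj_ofReal, ← Complex.ofReal_mul, div_mul_div_comm,
          Real.mul_self_sqrt (by positivity), Real.mul_self_sqrt (by positivity)]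
      · simp
    rw [Finset.sum_congr rfl fun x _ => this x, ← Complex.ofReal_sum, ← Finset.sum_div, hs,
      div_self hk.ne', Complex.ofReal_one]
  · refine Finset.sum_eq_zero fun x _ => ?_
    by_cases hx : weight x = k
    · rw [if_neg (fun h' => h (Fin.ext (hx.symm.trans h'))), mul_zero]
    · rw [if_neg hx, star_zero, zero_mul]

section Glue

variable {ℓ N : ℕ} {α : Finset (Fin N)}

lemma weight_glue (x : Config ℓ {i // i ∈ α}) (z : Config ℓ {i // i ∉ α}) :
    weight (glue x z) = weight x + weight z := by
  simp only [weight]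
  rw [← Fintype.sum_subtype_add_sum_subtype (fun i => i ∈ α)]
  congr 1
  · exact Finset.sum_congr (by ext; simp) fun i _ => by simp [glue, i.2]
  · exact Finset.sum_congr (by ext; simp) fun i _ => by simp [glue, i.2]

lemma multiplicity_glue (x : Config ℓ {i // i ∈ α}) (z : Config ℓ {i // i ∉ α}) :
    multiplicity (glue x z) = multiplicity x * multiplicity z := by
  simp only [multiplicity]
  rw [← Fintype.prod_subtype_mul_prod_subtype (fun i => i ∈ α)]
  congr 1
  · exact Finset.prod_congr (by ext; simp) fun i _ => by simp [glue, i.2]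
  · exact Finset.prod_congr (by ext; simp) fun i _ => by simp [glue, i.2]

/-- The reduced states of a Dicke state are hypergeometric mixtures of Dicke states. -/
lemma reduced_dicke {K : ℕ} (hK : ℓ * Fintype.card {i // i ∈ α} ≤ K) {c : ℂ}
    (hc : c * star c = 1) :
    reduced α (c • fun x => (dicke ℓ N K x : ℂ)) = dickeIsometry ℓ {i // i ∈ α} *
      Matrix.diagonal (fun k : Fin (ℓ * Fintype.card {i // i ∈ α} + 1) =>
        (hypergeom (ℓ * N) (ℓ * Fintype.card {i // i ∈ α}) K k : ℂ)) *
        (dickeIsometry ℓ {i // i ∈ α})ᴴ := by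
  set D := ℓ * Fintype.card {i // i ∈ α} with hD
  have hcard : ℓ * Fintype.card {i // i ∉ α} = ℓ * N - D := by
    rw [Fintype.card_subtype_compl, hD, ← Nat.mul_sub, Fintype.card_fin]
  ext x y
  have hL : reduced α (c • fun x => (dicke ℓ N K x : ℂ)) x y =
      ((∑ z : Config ℓ {i // i ∉ α}, dicke ℓ N K (glue x z) * dicke ℓ N K (glue y z) : ℝ) : ℂ) := by
    simp only [reduced, traceCompl, Matrix.of_apply, Matrix.vecMulVec_apply, Pi.smul_apply,
      Pi.star_apply, smul_eq_mul, Complex.ofReal_sum, Complex.ofReal_mul]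
    refine Finset.sum_congr rfl fun z _ => ?_
    have hr : star (dicke ℓ N K (glue y z) : ℂ) = dicke ℓ N K (glue y z) := Complex.conj_ofReal _
    rw [star_mul', hr]
    linear_combination ((dicke ℓ N K (glue x z) : ℂ) * dicke ℓ N K (glue y z)) * hc
  rw [hL, Matrix.mul_apply]
  simp only [Matrix.mul_diagonal, Matrix.conjTranspose_apply, dickeIsometry, Matrix.of_apply]
  have hx := weight_le x
  rw [Finset.sum_eq_single (⟨weight x, by omega⟩ : Fin (D + 1))]
  · simp only [if_true]
    by_cases hxy : weight y = weight x
    · rw [if_pos hxy, RCLike.star_def, Complex.conj_ofReal, ← Complex.ofReal_mul,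
        ← Complex.ofReal_mul]
      congr 1
      -- Vandermonde on the complement supplies the factor `(n - D).choose (K - k)`; `D.choose k`
      -- comes from the normalisation of the Dicke states on `α`. As `D ≤ K`, the subtraction `K -
      -- weight x` is not truncated.
      have hs := congrArg (Nat.cast (R := ℝ))
        (sum_multiplicity (ℓ := ℓ) (ι := {i // i ∉ α}) (K - weight x))
      rw [hcard] at hs
      push_cast at hs
      have : ∀ z : Config ℓ {i // i ∉ α}, dicke ℓ N K (glue x z) * dicke ℓ N K (glue y z) =
          √(multiplicity x : ℝ) * √(multiplicity y : ℝ) / (ℓ * N).choose K *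
          (if weight z = K - weight x then (multiplicity z : ℝ) else 0) := by
        intro z
        by_cases hz : weight z = K - weight x
        · rw [dicke, dicke, if_pos (by rw [weight_glue]; omega),
            if_pos (by rw [weight_glue]; omega), if_pos hz, multiplicity_glue, multiplicity_glue,
            div_mul_div_comm, Real.mul_self_sqrt (by positivity)]
          push_cast
          rw [Real.sqrt_mul (by positivity), Real.sqrt_mul (by positivity)]
          have := Real.mul_self_sqrt (show (0 : ℝ) ≤ multiplicity z by positivity)
          rw [div_mul_eq_mul_div]
          congr 1
          linear_combination (√(multiplicity x : ℝ) * √(multiplicity y : ℝ)) * this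
        · rw [dicke, if_neg (by rw [weight_glue]; omega), if_neg hz, zero_mul, mul_zero]
      rw [Finset.sum_congr rfl fun z _ => this z, ← Finset.mul_sum, hs, hypergeom]
      have hp : (0 : ℝ) < D.choose (weight x) := by exact_mod_cast Nat.choose_pos (by omega)
      have hsp := Real.sqrt_pos.2 hp
      simp only [← hD]
      field_simp
      rw [Real.sq_sqrt hp.le]
    · rw [if_neg hxy, star_zero, mul_zero, Complex.ofReal_eq_zero]
      -- No `z` completes both `x` and `y` to weight `K` when their weights differ.
      refine Finset.sum_eq_zero fun z _ => ?_
      by_cases hz : weight x + weight z = K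
      · rw [dicke, dicke, if_neg (c := weight (glue y z) = K) (by rw [weight_glue]; omega),
          mul_zero]
      · rw [dicke, if_neg (by rwa [weight_glue]), zero_mul]
  · intro k _ hk
    rw [if_neg (fun h => hk (Fin.ext h.symm)), zero_mul, zero_mul]
  · simp

end Glue

/-! ### Fidelity bounds. -/

/-- The fidelity of reduced states is a Bhattacharyya coefficient of hypergeometric
distributions. -/
theorem IsIrrepBasis.fidelity_reduced {ℓ N J : ℕ} (hJ : 2 * J = ℓ * N)
    {ψ : ℤ → Config ℓ (Fin N) → ℂ} (h : IsIrrepBasis ℓ N J ψ) (α : Finset (Fin N)) {K L : ℕ}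
    (hK : K ≤ ℓ * N) (hL : L ≤ ℓ * N) (hDK : ℓ * α.card ≤ K) (hDL : ℓ * α.card ≤ L) :
    fidelity (reduced α (ψ ((K : ℤ) - J))) (reduced α (ψ ((L : ℤ) - J))) =
      ∑ k : Fin (ℓ * α.card + 1), √(hypergeom (ℓ * N) (ℓ * α.card) K k) *
        √(hypergeom (ℓ * N) (ℓ * α.card) L k) := by
  obtain ⟨c, hc, hψ⟩ := h.eq_dicke hJ
  have hcard : Fintype.card {i // i ∈ α} = α.card := Fintype.card_coe α
  rw [hψ K hK, hψ L hL, reduced_dicke (by rwa [hcard]) hc, reduced_dicke (by rwa [hcard]) hc,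
    fidelity_conj_diagonal (dickeIsometry_conjTranspose_mul_self _ _)
      (fun k => hypergeom_nonneg _ _ _ _) (fun k => hypergeom_nonneg _ _ _ _), hcard]

/-- The nonasymptotic bound. -/
theorem IsIrrepBasis.abs_one_sub_fidelity_le {ℓ N J : ℕ} (hℓ : 1 ≤ ℓ) (hN : 0 < N)
    (hJ : 2 * J = ℓ * N) {ψ : ℤ → Config ℓ (Fin N) → ℂ} (h : IsIrrepBasis ℓ N J ψ)
    {α : Finset (Fin N)} (hα : 8 * α.card ≤ N) {M : ℤ} (hM : 8 * |M| ≤ N) :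
    |1 - fidelity (reduced α (ψ M)) (reduced α (ψ 0))| ≤
      320 * ((α.card : ℝ) * (M : ℝ) ^ 2 / (spin ℓ * (N : ℝ) ^ 2)) := by
  have hn : 0 < ℓ * N := Nat.mul_pos hℓ hN
  have hNn : N ≤ ℓ * N := Nat.le_mul_of_pos_left N hℓ
  have hD : 8 * (ℓ * α.card) ≤ ℓ * N := by
    rw [mul_left_comm]; exact Nat.mul_le_mul_left ℓ hα
  have hM' := abs_le.1 (show |M| ≤ (N : ℤ) / 8 by omega)
  -- `M` corresponds to `J + M` excitations and `0` to `J = n/2`; `8 |M| ≤ N ≤ n` keeps both in the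
  -- window `[3n/8, 5n/8]`. With `n = ℓN`, `D = ℓd` and `ℓ = 2s`, the constant 640 becomes 320.
  obtain ⟨K, hK⟩ : ∃ K : ℕ, (K : ℤ) = J + M := ⟨((J : ℤ) + M).toNat, by omega⟩
  have e1 : ψ M = ψ ((K : ℤ) - J) := by rw [hK]; congr 1; ring
  have e0 : ψ 0 = ψ ((J : ℤ) - J) := by rw [sub_self]
  generalize hn' : ℓ * N = n at *
  rw [e1, e0, h.fidelity_reduced (by omega) α (by omega) (by omega) (by omega) (by omega), hn']
  refine (abs_one_sub_sum_sqrt_hypergeom_le (t := M.natAbs) hn hD (by omega) (by omega) (by omega)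
    (by omega) (by omega)).trans (le_of_eq ?_)
  have ht : ((M.natAbs : ℕ) : ℝ) ^ 2 = (M : ℝ) ^ 2 := by
    rw [← Int.cast_natCast (R := ℝ), ← Int.cast_pow, Int.natAbs_sq, Int.cast_pow]
  rw [ht, ← hn', spin]
  have : (0 : ℝ) < ℓ := by exact_mod_cast hℓ
  have : (0 : ℝ) < N := by exact_mod_cast hN
  push_cast
  field_simp
  ring

/-- As `b < 1`, `N ^ b = o(N)`; the factor 8 is the one required by the nonasymptotic bound on `|M|`
and `d`. -/
lemma eventually_mul_abs_le_of_isBigO {f : ℕ → ℝ} {b : ℝ} (hb : b < 1)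
    (hf : f =O[atTop] fun N : ℕ => (N : ℝ) ^ b) : ∀ᶠ N : ℕ in atTop, 8 * |f N| ≤ N := by
  have h1 : (fun N : ℕ => (N : ℝ) ^ b) =o[atTop] fun N : ℕ => (N : ℝ) := by
    have h0 : Tendsto (fun N : ℕ => (N : ℝ) ^ (-(1 - b))) atTop (nhds 0) :=
      (tendsto_rpow_neg_atTop (sub_pos.2 hb)).comp tendsto_natCast_atTop_atTop
    have hne : ∀ᶠ N : ℕ in atTop, (N : ℝ) ≠ 0 := by
      filter_upwards [eventually_gt_atTop 0] with N hN
      exact_mod_cast hN.ne'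
    rw [isLittleO_iff_tendsto' (hne.mono fun N h h' => absurd h' h)]
    refine h0.congr' (hne.mono fun N h => ?_)
    rw [neg_sub, Real.rpow_sub_one h]
  have h2 := (hf.trans_isLittleO h1).bound (show (0 : ℝ) < 1 / 8 by norm_num)
  filter_upwards [h2] with N hN
  rw [Real.norm_eq_abs, Real.norm_natCast] at hN
  linarith

end SpinErasure
end

theorem lemma3 :
    ∃ C : ℝ, 0 < C ∧
      ∀ (ℓ : ℕ), 1 ≤ ℓ → ∀ (b c : ℝ), c ≤ b → b < 1 →
      ∀ (M : ℕ → ℤ) (α : (N : ℕ) → Finset (Fin N)),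
        (fun N : ℕ => (M N : ℝ)) =O[atTop] (fun N : ℕ => (N : ℝ) ^ b) →
        (fun N : ℕ => ((α N).card : ℝ)) =O[atTop] (fun N : ℕ => (N : ℝ) ^ c) →
        (∀ᶠ N : ℕ in atTop, ∀ J : ℕ, 2 * J = ℓ * N →
          ∀ ψ : ℤ → SpinErasure.Config ℓ (Fin N) → ℂ, SpinErasure.IsIrrepBasis ℓ N J ψ →
            |1 - SpinErasure.fidelity (SpinErasure.reduced (α N) (ψ (M N)))
                (SpinErasure.reduced (α N) (ψ 0))| ≤
              C * (((α N).card : ℝ) * (M N : ℝ) ^ 2 / (SpinErasure.spin ℓ * (N : ℝ) ^ 2))) ∧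
        (∃ K : ℝ, ∀ᶠ N : ℕ in atTop, ∀ J : ℕ, 2 * J = ℓ * N →
          ∀ ψ : ℤ → SpinErasure.Config ℓ (Fin N) → ℂ, SpinErasure.IsIrrepBasis ℓ N J ψ →
            |1 - SpinErasure.fidelity (SpinErasure.reduced (α N) (ψ (M N)))
                (SpinErasure.reduced (α N) (ψ 0))| ≤
              K * (N : ℝ) ^ (2 * b + c - 2)) := by
  refine ⟨320, by norm_num, fun ℓ hℓ b c hcb hb M α hM hα => ?_⟩
  have main : ∀ᶠ N : ℕ in atTop, ∀ J : ℕ, 2 * J = ℓ * N →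
      ∀ ψ : ℤ → SpinErasure.Config ℓ (Fin N) → ℂ, SpinErasure.IsIrrepBasis ℓ N J ψ →
        |1 - SpinErasure.fidelity (SpinErasure.reduced (α N) (ψ (M N)))
            (SpinErasure.reduced (α N) (ψ 0))| ≤
          320 * (((α N).card : ℝ) * (M N : ℝ) ^ 2 / (SpinErasure.spin ℓ * (N : ℝ) ^ 2)) := by
    filter_upwards [SpinErasure.eventually_mul_abs_le_of_isBigO hb hM,
      SpinErasure.eventually_mul_abs_le_of_isBigO (hcb.trans_lt hb) hα, eventually_gt_atTop 0]
      with N h1 h2 hN J hJ ψ hψ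
    rw [Nat.abs_cast] at h2
    exact hψ.abs_one_sub_fidelity_le hℓ hN hJ (by exact_mod_cast h2) (by exact_mod_cast h1)
  refine ⟨main, ?_⟩
  obtain ⟨A, hA, hM'⟩ := hM.exists_pos
  obtain ⟨B, hB, hα'⟩ := hα.exists_pos
  refine ⟨320 * (B * A ^ 2 / SpinErasure.spin ℓ), ?_⟩
  filter_upwards [main, hM'.bound, hα'.bound, eventually_gt_atTop 0]
    with N h h1 h2 hN J hJ ψ hψ
  refine (h J hJ ψ hψ).trans ?_
  have hNr : (0 : ℝ) < N := by exact_mod_cast hN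
  have hs : 0 < SpinErasure.spin ℓ := by
    have : (0 : ℝ) < ℓ := by exact_mod_cast hℓ
    rw [SpinErasure.spin]; positivity
  rw [Real.norm_eq_abs, Real.norm_of_nonneg (by positivity)] at h1
  rw [Real.norm_natCast, Real.norm_of_nonneg (by positivity)] at h2
  have hpow : (N : ℝ) ^ (2 * b + c - 2) = ((N : ℝ) ^ b) ^ 2 * (N : ℝ) ^ c / (N : ℝ) ^ 2 := by
    rw [Real.rpow_sub hNr, Real.rpow_add hNr, mul_comm 2 b, Real.rpow_mul hNr.le]
    norm_cast
  calc 320 * (((α N).card : ℝ) * (M N : ℝ) ^ 2 / (SpinErasure.spin ℓ * (N : ℝ) ^ 2))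
      ≤ 320 * ((B * (N : ℝ) ^ c) * (A * (N : ℝ) ^ b) ^ 2 /
        (SpinErasure.spin ℓ * (N : ℝ) ^ 2)) := by
        rw [← sq_abs (M N : ℝ)]
        gcongr
    _ = _ := by rw [hpow]; field_simp
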